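/- Let $k$ be an algebraically closed field of characteristic $0$ and $n\ge 1$. Identify $S_n$ with the group of permutations of $\mathbb{Z}/n=\{1,\dots,n\}$, let $C_n=\langle a\rangle$ with $a=(1\,2\cdots n)$, and let $S_{n-1}\subset S_n$ be the subgroup fixing $n$. The factorization $S_n=C_nS_{n-1}$ gives a matched pair of actions by writing $xb=(x\rhd b)(x\lhd b)$ with $x\in S_{n-1}$, $b,\ x\rhd b\in C_n$, $x\lhd b\in S_{n-1}$. Let $J_n=k^{S_{n-1}}\#kC_n$ be the corresponding bismash product: the Hopf algebra with basis $p_x\#b$ ($x\in S_{n-1}$, $b\in C_n$), multiplication $(p_x\#b)(p_y\#c)=\delta_{y,x\lhd b}\,p_x\#bc$, unit $\sum_x p_x\#1$, counit $\varepsilon(p_x\#b)=\delta_{x,1}$, comultiplication $\Delta(p_x\#b)=\sum_{y}(p_{xy^{-1}}\#(y\rhd b))\otimes(p_y\#b)$ and antipode $S(p_x\#b)=p_{(x\lhd b)^{-1}}\#(x\rhd b)^{-1}$. The (Frobenius–Schur) indicator of a finite-dimensional $J_n$-module with character $\chi$ is $\nu(\chi)=\chi\left(\sum\Lambda_1\Lambda_2\right)\in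 k$, where $\Lambda$ is the two-sided integral of $J_n$ with $\varepsilon(\Lambda)=1$ and $\Delta(\Lambda)=\sum\Lambda_1\otimes\Lambda_2$. For $x\in S_{n-1}$ let $\mathcal{O}_x=\{x\lhd b\mid b\in C_n\}$ and $F_x=\{b\in C_n\mid x\lhd b=x\}$. A representation $V$ of $F_x$ induces the $J_n$-module $\hat V=kC_n\otimes_{kF_x}V$ with action $(p_y\#b)\cdot(c\otimes v)=\delta_{y\lhd(bc),x}\,(bc\otimes v)$; write $\hat\chi$ for its character. Then: 1. If $n$ is odd, or $n=2m$ with $m$ odd, then every irreducible representation of $J_n$ has indicator $0$ or $+1$. 2. Let $x\in S_{n-1}$ with $F_x=\langle a^t\rangle$, $t\mid n$, and let $\hat\chi$ be the character of $J_n$ induced from an irreducible representation of $F_x$. If $t$ is odd, or $\mathcal{O}_x$ contains a permutation $y$ with $y^2=1$, or $n=2m$ with $m$ odd, then $\nu(\hat\chi)$ is $0$ or $+1$. 3. If $x\in S_{n-1}$ and $y\in\mathcal{O}_x$, then $F_y=F_x$, and for every irreducible representation of $F_x=F_y$, the characters $\hat\chi_x$ and $\hat\chi_y$ of $J_n$ induced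 from it at $x$ and at $y$ have the same indicator. -/

import Mathlib

open scoped TensorProduct

noncomputable section

namespace FSInd

/-! ### Frobenius-Schur indicators for Hopf algebras -/

section Indicator

variable (k : Type*) {H : Type*} [Field k] [Ring H] [HopfAlgebra k H]

/-- `Λ` is a two-sided integral of `H`, normalized by `ε(Λ) = 1`. -/
structure IsNormalizedIntegral (Λ : H) : Prop where
  left : ∀ h : H, h * Λ = Coalgebra.counit (R := k) h • Λ
  right : ∀ h : H, Λ * h = Coalgebra.counit (R := k) h • Λ
  counit_eq_one : Coalgebra.counit (R := k) Λ = 1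

variable {k} in
theorem IsNormalizedIntegral.unique {Λ Λ' : H} (h : IsNormalizedIntegral k Λ)
    (h' : IsNormalizedIntegral k Λ') : Λ = Λ' := by
  have h1 := h.right Λ'
  have h2 := h'.left Λ
  rw [h'.counit_eq_one, one_smul] at h1
  rw [h.counit_eq_one, one_smul] at h2
  exact h1.symm.trans h2

variable (H) in
open Classical in
/-- The normalized two-sided integral of `H`; it is unique when it exists, and it exists for the
bismash products below (`Bismash.isNormalizedIntegral_haar`). -/
def normalizedIntegral : H :=
  if h : ∃ Λ : H, IsNormalizedIntegral k Λ then h.choose else 0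

variable {k} in
theorem normalizedIntegral_eq {Λ : H} (h : IsNormalizedIntegral k Λ) :
    normalizedIntegral k H = Λ := by
  have hex : ∃ Λ : H, IsNormalizedIntegral k Λ := ⟨Λ, h⟩
  rw [normalizedIntegral, dif_pos hex]
  exact hex.choose_spec.unique h

variable (H) in
/-- The (second) Frobenius-Schur indicator `ν(χ) = χ(∑ Λ₁ Λ₂)` of the `H`-module `V` with
character `χ`, where `Λ` is the normalized integral of `H`. -/
def indicator (V : Type*) [AddCommGroup V] [Module k V] [Module H V] [IsScalarTower k H V] : k :=
  LinearMap.trace k V (Algebra.lsmul k k V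
    (LinearMap.mul' k H (Coalgebra.comul (R := k) (normalizedIntegral k H))))

end Indicator

/-! ### Matched pairs -/

/-- A matched pair of groups: `tri x a` is `x ▷ a`, a left action of `G` on the set `F`, and
`act x a` is `x ◁ a`, a right action of `F` on the set `G`. -/
structure MatchedPair (F G : Type*) [Group F] [Group G] where
  tri : G → F → F
  act : G → F → G
  one_tri : ∀ a, tri 1 a = a
  mul_tri : ∀ x y a, tri (x * y) a = tri x (tri y a)
  act_one : ∀ x, act x 1 = x
  act_mul : ∀ x a b, act x (a * b) = act (act x a) b
  tri_mul : ∀ x a b, tri x (a * b) = tri x a * tri (act x a) b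
  mul_act : ∀ x y a, act (x * y) a = act x (tri y a) * act y a

namespace MatchedPair

variable {F G : Type*} [Group F] [Group G] (M : MatchedPair F G)

@[simp] theorem tri_one (x : G) : M.tri x 1 = 1 := by
  have h := M.tri_mul x 1 1
  rw [mul_one, M.act_one] at h
  exact left_eq_mul.mp h

@[simp] theorem one_act (a : F) : M.act 1 a = 1 := by
  have h := M.mul_act 1 1 a
  rw [mul_one, M.one_tri] at h
  exact left_eq_mul.mp h

theorem inv_act (x : G) (a : F) : (M.act x a)⁻¹ = M.act x⁻¹ (M.tri x a) := by
  have h := M.mul_act x⁻¹ x a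
  rw [inv_mul_cancel, one_act] at h
  exact inv_eq_of_mul_eq_one_left h.symm

theorem act_inj {x y : G} {a : F} (h : M.act x a = M.act y a) : x = y := by
  have := congrArg (fun z => M.act z a⁻¹) h
  simpa [← M.act_mul, M.act_one] using this

/-- The matched pair of a factorizable group `L = FG`, `F ∩ G = 1`: `x ▷ b` and `x ◁ b` are the
components of `x b = (x ▷ b)(x ◁ b)`. -/
def ofComplement {L : Type*} [Group L] {F G : Subgroup L} (h : F.IsComplement' G) :
    MatchedPair F G :=
  have key : ∀ (l : L) (a : F) (x : G), (a : L) * x = l → h.equiv l = (a, x) := by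
    intro l a x hl
    rw [← hl]
    exact h.equiv.apply_symm_apply (a, x)
  have spec : ∀ l : L, ((h.equiv l).1 : L) * (h.equiv l).2 = l := fun l =>
    h.equiv_fst_mul_equiv_snd l
  have one_eq : ∀ a : F, h.equiv ((1 : G) * (a : L)) = (a, 1) := fun a => key _ _ _ (by simp)
  have one_eq' : ∀ x : G, h.equiv ((x : L) * (1 : F)) = (1, x) := fun x => key _ _ _ (by simp)
  have mul_eq : ∀ (x y : G) (a : F), h.equiv (((x * y : G) : L) * a) =
      ((h.equiv ((x : L) * (h.equiv ((y : L) * a)).1)).1,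
        (h.equiv ((x : L) * (h.equiv ((y : L) * a)).1)).2 * (h.equiv ((y : L) * a)).2) := by
    intro x y a
    apply key
    rw [Subgroup.coe_mul, ← mul_assoc, spec, mul_assoc, spec, Subgroup.coe_mul, mul_assoc]
  have mul_eq' : ∀ (x : G) (a b : F), h.equiv ((x : L) * ((a * b : F) : L)) =
      ((h.equiv ((x : L) * a)).1 * (h.equiv (((h.equiv ((x : L) * a)).2 : L) * b)).1,
        (h.equiv (((h.equiv ((x : L) * a)).2 : L) * b)).2) := by
    intro x a b
    apply key
    rw [Subgroup.coe_mul, mul_assoc, spec, ← mul_assoc, spec, Subgroup.coe_mul, mul_assoc]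
  { tri := fun x b => (h.equiv ((x : L) * b)).1
    act := fun x b => (h.equiv ((x : L) * b)).2
    one_tri := fun a => congrArg Prod.fst (one_eq a)
    mul_tri := fun x y a => by simp only [mul_eq]
    act_one := fun x => congrArg Prod.snd (one_eq' x)
    act_mul := fun x a b => by simp only [mul_eq']
    tri_mul := fun x a b => congrArg Prod.fst (mul_eq' x a b)
    mul_act := fun x y a => congrArg Prod.snd (mul_eq x y a) }

/-- The orbit `O_x = {x ◁ b | b ∈ F}`. -/
def orbit (x : G) : Set G := Set.range fun b : F => M.act x b

/-- The stabilizer `F_x = {b ∈ F | x ◁ b = x}`. -/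
def stab (x : G) : Subgroup F where
  carrier := {b | M.act x b = x}
  one_mem' := M.act_one x
  mul_mem' := fun {a b} ha hb => by
    change M.act x (a * b) = x
    rw [M.act_mul, show M.act x a = x from ha, show M.act x b = x from hb]
  inv_mem' := fun {a} ha => by
    apply M.act_inj (a := a)
    rw [← M.act_mul, inv_mul_cancel, M.act_one]
    exact (show M.act x a = x from ha).symm

theorem mem_stab {x : G} {b : F} : b ∈ M.stab x ↔ M.act x b = x := Iff.rfl

end MatchedPair

/-! ### The bismash product `k^G # kF` -/

section BismashDef

variable (k : Type*) {F G : Type*} [Field k] [Group F] [Group G]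

/-- The underlying space of the bismash product `k^G # kF`, with basis `p_x # a`,
for `x ∈ G` and `a ∈ F`. -/
def Bismash (_M : MatchedPair F G) : Type _ := G × F →₀ k

variable (M : MatchedPair F G)

namespace Bismash

instance : AddCommGroup (Bismash k M) := inferInstanceAs (AddCommGroup (G × F →₀ k))

instance : Module k (Bismash k M) := inferInstanceAs (Module k (G × F →₀ k))

/-- The basis `p_x # a`, indexed by `(x, a)`. -/
def basis : Module.Basis (G × F) k (Bismash k M) := Finsupp.basisSingleOne

/-- The basis element `p_x # a`. -/
def p (x : G) (a : F) : Bismash k M := basis k M (x, a)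

variable {k M}

/-- The linear map with prescribed values on the elements `p_x # a`. -/
def lift {N : Type*} [AddCommGroup N] [Module k N] (f : G → F → N) : Bismash k M →ₗ[k] N :=
  (basis k M).constr k fun q => f q.1 q.2

@[simp] theorem lift_p {N : Type*} [AddCommGroup N] [Module k N] (f : G → F → N) (x : G) (a : F) :
    lift f (p k M x a) = f x a := by
  simp [lift, p]

theorem hom_ext {N : Type*} [AddCommMonoid N] [Module k N] {f g : Bismash k M →ₗ[k] N}
    (h : ∀ x a, f (p k M x a) = g (p k M x a)) : f = g :=
  (basis k M).ext fun q => h q.1 q.2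

variable (k M)

open Classical in
/-- Multiplication `(p_x # a)(p_y # b) = δ_{y, x ◁ a} p_x # ab`. -/
def mulHom : Bismash k M →ₗ[k] Bismash k M →ₗ[k] Bismash k M :=
  lift fun x a => lift fun y b => if y = M.act x a then p k M x (a * b) else 0

instance : Mul (Bismash k M) := ⟨fun u v => mulHom k M u v⟩

variable {k M}

theorem mul_def (u v : Bismash k M) : u * v = mulHom k M u v := rfl

open Classical in
theorem p_mul_p (x y : G) (a b : F) :
    p k M x a * p k M y b = if y = M.act x a then p k M x (a * b) else 0 := by
  simp [mul_def, mulHom]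

theorem induction {P : Bismash k M → Prop} (u : Bismash k M) (hp : ∀ x a, P (p k M x a))
    (hadd : ∀ u v, P u → P v → P (u + v)) (hsmul : ∀ (c : k) u, P u → P (c • u)) : P u := by
  have hu : u ∈ Submodule.span k (Set.range (basis k M)) := by
    rw [(basis k M).span_eq]; trivial
  induction hu using Submodule.span_induction with
  | mem v hv => obtain ⟨q, rfl⟩ := hv; exact hp q.1 q.2
  | zero => simpa using hsmul 0 _ (hp 1 1)
  | add v w _ _ hv hw => exact hadd v w hv hw
  | smul c v _ hv => exact hsmul c v hv

instance : NonUnitalNonAssocRing (Bismash k M) where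
  left_distrib u v w := by simp [mul_def]
  right_distrib u v w := by simp [mul_def]
  zero_mul u := by simp [mul_def]
  mul_zero u := by simp [mul_def]

protected theorem smul_mul' (c : k) (u v : Bismash k M) : c • u * v = c • (u * v) := by
  simp [mul_def]

protected theorem mul_smul' (c : k) (u v : Bismash k M) : u * c • v = c • (u * v) := by
  simp [mul_def]

protected theorem mul_assoc' (u v w : Bismash k M) : u * v * w = u * (v * w) := by
  classical
  induction u using induction with
  | hadd u u' h h' => simp only [add_mul, h, h']
  | hsmul c u h => simp only [Bismash.smul_mul', h]
  | hp x a =>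
  induction v using induction with
  | hadd u u' h h' => simp only [add_mul, mul_add, h, h']
  | hsmul c u h => simp only [Bismash.smul_mul', Bismash.mul_smul', h]
  | hp y b =>
  induction w using induction with
  | hadd u u' h h' => simp only [mul_add, h, h']
  | hsmul c u h => simp only [Bismash.mul_smul', h]
  | hp z c =>
  by_cases h : y = M.act x a
  · subst h
    simp only [p_mul_p, if_true, M.act_mul, mul_assoc, mul_ite, mul_zero]
  · simp only [p_mul_p, if_neg h, zero_mul, mul_ite, mul_zero, ite_self]

variable [Fintype G]

/-- The unit `1 # 1 = ∑ x, p_x # 1`. -/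
instance : One (Bismash k M) := ⟨∑ x : G, p k M x 1⟩

theorem one_def : (1 : Bismash k M) = ∑ x : G, p k M x 1 := rfl

protected theorem one_mul' (u : Bismash k M) : 1 * u = u := by
  classical
  induction u using induction with
  | hadd u u' h h' => simp only [mul_add, h, h']
  | hsmul c u h => simp only [Bismash.mul_smul', h]
  | hp x a => simp [one_def, Finset.sum_mul, p_mul_p, M.act_one]

protected theorem mul_one' (u : Bismash k M) : u * 1 = u := by
  classical
  induction u using induction with
  | hadd u u' h h' => simp only [add_mul, h, h']
  | hsmul c u h => simp only [Bismash.smul_mul', h]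
  | hp x a => simp [one_def, Finset.mul_sum, p_mul_p]

instance : Ring (Bismash k M) :=
  { (inferInstance : NonUnitalNonAssocRing (Bismash k M)) with
    mul_assoc := Bismash.mul_assoc'
    one_mul := Bismash.one_mul'
    mul_one := Bismash.mul_one' }

instance : Algebra k (Bismash k M) := Algebra.ofModule Bismash.smul_mul' Bismash.mul_smul'

variable (k M)

open Classical in
/-- The coalgebra maps `ε(p_x # a) = δ_{x,1}` and
`Δ(p_x # a) = ∑ y, (p_{x y⁻¹} # (y ▷ a)) ⊗ (p_y # a)`. -/
instance : CoalgebraStruct k (Bismash k M) where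
  comul := lift fun x a => ∑ y : G, p k M (x * y⁻¹) (M.tri y a) ⊗ₜ[k] p k M y a
  counit := lift fun x _ => if x = 1 then 1 else 0

variable {k M}

theorem comul_p (x : G) (a : F) : Coalgebra.comul (R := k) (p k M x a) =
    ∑ y : G, p k M (x * y⁻¹) (M.tri y a) ⊗ₜ[k] p k M y a :=
  lift_p _ _ _

open Classical in
theorem counit_p (x : G) (a : F) : Coalgebra.counit (R := k) (p k M x a) =
    if x = 1 then 1 else 0 :=
  lift_p _ _ _

instance : Coalgebra k (Bismash k M) where
  coassoc := hom_ext fun x a => by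
    simp only [LinearMap.comp_apply, comul_p, map_sum, LinearMap.rTensor_tmul,
      LinearMap.lTensor_tmul, LinearEquiv.coe_coe, TensorProduct.sum_tmul, TensorProduct.tmul_sum,
      TensorProduct.assoc_tmul, ← M.mul_tri]
    conv_rhs => rw [Finset.sum_comm]
    exact Finset.sum_congr rfl fun z _ =>
      Fintype.sum_equiv (Equiv.mulRight z) _ _ fun y => by simp [mul_assoc]
  rTensor_counit_comp_comul := hom_ext fun x a => by
    classical
    simp only [LinearMap.comp_apply, comul_p, map_sum, LinearMap.rTensor_tmul, counit_p,
      TensorProduct.ite_tmul, mul_inv_eq_one, TensorProduct.mk_apply]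
    simp
  lTensor_counit_comp_comul := hom_ext fun x a => by
    classical
    simp only [LinearMap.comp_apply, comul_p, map_sum, LinearMap.lTensor_tmul, counit_p,
      TensorProduct.tmul_ite]
    simp [M.one_tri]

protected theorem counit_mul' (u v : Bismash k M) : Coalgebra.counit (R := k) (u * v) =
    Coalgebra.counit (R := k) u * Coalgebra.counit (R := k) v := by
  classical
  induction u using induction with
  | hadd u u' h h' => simp only [add_mul, map_add, h, h']
  | hsmul c u h => simp only [Bismash.smul_mul', map_smul, h, smul_eq_mul, mul_assoc]
  | hp x a =>
  induction v using induction with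
  | hadd u u' h h' => simp only [mul_add, map_add, h, h']
  | hsmul c u h => simp only [Bismash.mul_smul', map_smul, h, smul_eq_mul, mul_left_comm]
  | hp y b =>
  by_cases hx : x = 1
  · subst hx
    by_cases hy : y = 1 <;> simp [p_mul_p, counit_p, hy]
  · by_cases h : y = M.act x a <;> simp [p_mul_p, counit_p, h, hx]

protected theorem comul_mul' (u v : Bismash k M) : Coalgebra.comul (R := k) (u * v) =
    Coalgebra.comul (R := k) u * Coalgebra.comul (R := k) v := by
  classical
  induction u using induction with
  | hadd u u' h h' => simp only [add_mul, map_add, h, h']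
  | hsmul c u h => simp only [map_smul, h, smul_mul_assoc]
  | hp x a =>
  induction v using induction with
  | hadd u u' h h' => simp only [mul_add, map_add, h, h']
  | hsmul c u h => simp only [map_smul, h, mul_smul_comm]
  | hp z b =>
  have key : ∀ y w : G, z * w⁻¹ = M.act (x * y⁻¹) (M.tri y a) ∧ w = M.act y a ↔
      w = M.act y a ∧ z = M.act x a := by
    intro y w
    have h := M.mul_act (x * y⁻¹) y a
    rw [inv_mul_cancel_right] at h
    constructor
    · rintro ⟨h1, rfl⟩
      exact ⟨rfl, by rw [h, ← h1, inv_mul_cancel_right]⟩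
    · rintro ⟨rfl, rfl⟩
      exact ⟨by rw [h, mul_inv_cancel_right], rfl⟩
  simp only [comul_p, p_mul_p, Finset.sum_mul_sum, Algebra.TensorProduct.tmul_mul_tmul]
  have : ∀ y w : G, ((if z * w⁻¹ = M.act (x * y⁻¹) (M.tri y a) then
        p k M (x * y⁻¹) (M.tri y a * M.tri w b) else 0) ⊗ₜ[k]
      (if w = M.act y a then p k M y (a * b) else 0)) =
      if w = M.act y a then (if z = M.act x a then
        p k M (x * y⁻¹) (M.tri y a * M.tri w b) ⊗ₜ[k] p k M y (a * b) else 0) else 0 := by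
    intro y w
    rw [← ite_and, ← if_congr (key y w) rfl rfl, ite_and, TensorProduct.ite_tmul]
    split_ifs <;> simp
  refine Eq.trans ?_ (Finset.sum_congr rfl fun y _ => Finset.sum_congr rfl fun w _ =>
    this y w).symm
  simp only [Finset.sum_ite_eq', Finset.mem_univ, if_true, ← M.tri_mul]
  split_ifs <;> simp [comul_p]

instance : Bialgebra k (Bismash k M) :=
  Bialgebra.mk' k (Bismash k M)
    (by classical simp [one_def, counit_p])
    (by intro u v; exact Bismash.counit_mul' u v)
    (by
      simp only [one_def, map_sum, comul_p, M.tri_one, Algebra.TensorProduct.one_def,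
        TensorProduct.sum_tmul, TensorProduct.tmul_sum]
      rw [Finset.sum_comm]
      exact Finset.sum_congr rfl fun y _ =>
        Fintype.sum_equiv (Equiv.mulRight y⁻¹) _ _ fun x => by simp)
    (by intro u v; exact Bismash.comul_mul' u v)

/-- The antipode `S(p_x # a) = p_{(x ◁ a)⁻¹} # (x ▷ a)⁻¹`. -/
instance : HopfAlgebraStruct k (Bismash k M) where
  antipode := lift fun x a => p k M (M.act x a)⁻¹ (M.tri x a)⁻¹

theorem antipode_p (x : G) (a : F) : HopfAlgebraStruct.antipode k (p k M x a) =
    p k M (M.act x a)⁻¹ (M.tri x a)⁻¹ :=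
  lift_p _ _ _

instance : HopfAlgebra k (Bismash k M) where
  mul_antipode_rTensor_comul := hom_ext fun x a => by
    classical
    simp only [LinearMap.comp_apply, comul_p, map_sum, LinearMap.rTensor_tmul, antipode_p,
      LinearMap.mul'_apply, p_mul_p, counit_p, ← M.mul_tri, inv_mul_cancel_right]
    have key : ∀ y : G, M.act (M.act (x * y⁻¹) (M.tri y a))⁻¹ (M.tri x a)⁻¹ = y * x⁻¹ := by
      intro y
      rw [M.inv_act, ← M.mul_tri, inv_mul_cancel_right, ← M.act_mul, mul_inv_cancel, M.act_one,
        mul_inv_rev, inv_inv]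
    simp only [key, left_eq_mul, inv_eq_one]
    by_cases hx : x = 1
    · subst hx
      simp only [if_true, one_mul, ← M.inv_act, inv_inv, M.one_tri, inv_mul_cancel,
        Algebra.linearMap_apply, map_one, one_def]
      exact Function.Bijective.sum_comp
        (Finite.injective_iff_bijective.mp fun y z h => M.act_inj h) fun y => p k M y 1
    · simp [hx]
  mul_antipode_lTensor_comul := hom_ext fun x a => by
    classical
    simp only [LinearMap.comp_apply, comul_p, map_sum, LinearMap.lTensor_tmul, antipode_p,
      LinearMap.mul'_apply, p_mul_p, counit_p]
    have key : ∀ y : G, (M.act y a)⁻¹ = M.act (x * y⁻¹) (M.tri y a) ↔ x = 1 := by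
      intro y
      have h := M.mul_act (x * y⁻¹) y a
      rw [inv_mul_cancel_right] at h
      rw [inv_eq_iff_eq_inv, eq_comm, inv_eq_iff_mul_eq_one, ← h]
      exact ⟨fun h => M.act_inj (h.trans (M.one_act a).symm), fun h => by rw [h, M.one_act]⟩
    simp only [key, mul_inv_cancel]
    by_cases hx : x = 1
    · subst hx
      simp only [if_true, one_mul, Algebra.linearMap_apply, map_one, one_def]
      exact Fintype.sum_equiv (Equiv.inv G) _ _ fun y => by simp
    · simp [hx]

/-- The explicit normalized integral `|F|⁻¹ ∑ a, p_1 # a`. -/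
theorem isNormalizedIntegral_haar [Fintype F] [CharZero k] :
    IsNormalizedIntegral k ((Fintype.card F : k)⁻¹ • ∑ a : F, p k M 1 a) where
  left u := by
    classical
    induction u using induction with
    | hadd u u' h h' => simp only [add_mul, map_add, add_smul, h, h']
    | hsmul c u h => simp only [Bismash.smul_mul', map_smul, h, smul_assoc]
    | hp x b =>
    rw [mul_smul_comm, smul_comm (Coalgebra.counit (R := k) _), counit_p, Finset.mul_sum]
    congr 1
    by_cases hx : x = 1
    · subst hx
      simp only [p_mul_p, M.one_act, if_true, one_smul]
      exact Fintype.sum_equiv (Equiv.mulLeft b) _ _ fun y => by simp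
    · have : ¬ 1 = M.act x b := fun h => hx (M.act_inj (h.symm.trans (M.one_act b).symm))
      simp [p_mul_p, this, hx]
  right u := by
    classical
    induction u using induction with
    | hadd u u' h h' => simp only [mul_add, map_add, add_smul, h, h']
    | hsmul c u h => simp only [Bismash.mul_smul', map_smul, h, smul_assoc]
    | hp x b =>
    rw [smul_mul_assoc, smul_comm (Coalgebra.counit (R := k) _), counit_p, Finset.sum_mul]
    congr 1
    by_cases hx : x = 1
    · subst hx
      simp only [p_mul_p, M.one_act, if_true, one_smul]
      exact Fintype.sum_equiv (Equiv.mulRight b) _ _ fun y => by simp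
    · simp [p_mul_p, hx]
  counit_eq_one := by
    simp [counit_p]

end Bismash

/-! ### Induced modules -/

namespace MatchedPair

variable {k}
variable {x : G} {V : Type*} [AddCommGroup V] [Module k V]

/-- The relations `bc ⊗ v = b ⊗ cv`, for `b ∈ F` and `c ∈ F_x`. -/
def inducedRel (ρ : Representation k (M.stab x) V) : Submodule k (F →₀ V) :=
  Submodule.span k {w | ∃ (b : F) (c : M.stab x) (v : V),
    w = Finsupp.single (b * c) v - Finsupp.single b (ρ c v)}

/-- The space `kF ⊗_{kF_x} V`: the quotient of `kF ⊗ V = ⨁_{b ∈ F} b ⊗ V` by the relations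
`bc ⊗ v = b ⊗ cv`, for `b ∈ F` and `c ∈ F_x`. -/
def Induced (ρ : Representation k (M.stab x) V) : Type _ := (F →₀ V) ⧸ M.inducedRel ρ

namespace Induced

variable (ρ : Representation k (M.stab x) V)

instance : AddCommGroup (M.Induced ρ) := inferInstanceAs (AddCommGroup ((F →₀ V) ⧸ M.inducedRel ρ))

instance : Module k (M.Induced ρ) := inferInstanceAs (Module k ((F →₀ V) ⧸ M.inducedRel ρ))

/-- The map `v ↦ b ⊗ v`. -/
def tmul (b : F) : V →ₗ[k] M.Induced ρ := (M.inducedRel ρ).mkQ ∘ₗ Finsupp.lsingle b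

theorem tmul_smul (b : F) (c : M.stab x) (v : V) :
    tmul M ρ (b * c) v = tmul M ρ b (ρ c v) := by
  refine (Submodule.Quotient.eq _).mpr (Submodule.subset_span ⟨b, c, v, rfl⟩)

variable {M ρ} in
theorem hom_ext {N : Type*} [AddCommGroup N] [Module k N] {f g : M.Induced ρ →ₗ[k] N}
    (h : ∀ b v, f (tmul M ρ b v) = g (tmul M ρ b v)) : f = g := by
  refine Submodule.linearMap_qext _ (Finsupp.lhom_ext fun b v => h b v)

open Classical in
/-- The action of `p_y # a`, sending `b ⊗ v` to `δ_{y ◁ (ab), x} (ab ⊗ v)`. -/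
def pAct (y : G) (a : F) : M.Induced ρ →ₗ[k] M.Induced ρ :=
  (M.inducedRel ρ).liftQ
    (Finsupp.lsum k fun b => if M.act y (a * b) = x then tmul M ρ (a * b) else 0) <| by
      rw [inducedRel, Submodule.span_le]
      rintro _ ⟨b, c, v, rfl⟩
      have h : M.act y (a * (b * c)) = x ↔ M.act y (a * b) = x := by
        rw [← mul_assoc, M.act_mul]
        refine ⟨fun h => M.act_inj (h.trans (M.mem_stab.mp c.2).symm), fun h => ?_⟩
        rw [h]
        exact c.2
      by_cases h' : M.act y (a * b) = x
      · have e := tmul_smul M ρ (a * b) c v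
        rw [mul_assoc] at e
        rw [SetLike.mem_coe, LinearMap.mem_ker, map_sub, Finsupp.lsum_single, Finsupp.lsum_single,
          if_pos h', if_pos (h.mpr h'), e, sub_self]
      · rw [SetLike.mem_coe, LinearMap.mem_ker, map_sub, Finsupp.lsum_single, Finsupp.lsum_single,
          if_neg h', if_neg (mt h.mp h'), LinearMap.zero_apply, LinearMap.zero_apply, sub_self]

open Classical in
theorem pAct_tmul (y : G) (a b : F) (v : V) : pAct M ρ y a (tmul M ρ b v) =
    if M.act y (a * b) = x then tmul M ρ (a * b) v else 0 := by
  have : pAct M ρ y a (tmul M ρ b v) =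
      (if M.act y (a * b) = x then tmul M ρ (a * b) else 0 : V →ₗ[k] M.Induced ρ) v :=
    Finsupp.lsum_single k _ b v
  rw [this]
  split_ifs <;> rfl

/-- The action of the bismash product on `kF ⊗_{kF_x} V`, as a linear map. -/
def actHom : Bismash k M →ₗ[k] Module.End k (M.Induced ρ) :=
  Bismash.lift fun y a => pAct M ρ y a

theorem actHom_mul (u w : Bismash k M) :
    actHom M ρ (u * w) = actHom M ρ u * actHom M ρ w := by
  classical
  induction u using Bismash.induction with
  | hadd u u' h h' => simp only [add_mul, map_add, h, h']
  | hsmul c u h => simp only [Bismash.smul_mul', map_smul, h, smul_mul_assoc]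
  | hp y a =>
  induction w using Bismash.induction with
  | hadd u u' h h' => simp only [mul_add, map_add, h, h']
  | hsmul c u h => simp only [Bismash.mul_smul', map_smul, h, mul_smul_comm]
  | hp z b =>
  refine hom_ext fun d v => ?_
  have e : M.act y (a * (b * d)) = M.act (M.act y a) (b * d) := M.act_mul ..
  by_cases h : z = M.act y a
  · subst h
    by_cases h' : M.act (M.act y a) (b * d) = x <;>
      simp [actHom, Bismash.p_mul_p, pAct_tmul, mul_assoc, e, h']
  · by_cases h' : M.act z (b * d) = x
    · have : ¬ M.act (M.act y a) (b * d) = x := fun h'' =>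
        h (M.act_inj (h'.trans h''.symm))
      simp [actHom, Bismash.p_mul_p, pAct_tmul, e, h, h', this]
    · simp [actHom, Bismash.p_mul_p, pAct_tmul, h, h']

variable [Fintype G]

theorem actHom_one : actHom M ρ 1 = 1 := by
  classical
  refine hom_ext fun d v => ?_
  have key : ∀ y : G, M.act y d = x ↔ y = M.act x d⁻¹ := by
    intro y
    constructor
    · rintro rfl
      rw [← M.act_mul, mul_inv_cancel, M.act_one]
    · rintro rfl
      rw [← M.act_mul, inv_mul_cancel, M.act_one]
  simp [actHom, Bismash.one_def, pAct_tmul, key, LinearMap.sum_apply]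

/-- The bismash product acts on `kF ⊗_{kF_x} V` by
`(p_y # a)(b ⊗ v) = δ_{y ◁ (ab), x} (ab ⊗ v)`. -/
instance : Module (Bismash k M) (M.Induced ρ) :=
  Module.compHom (M.Induced ρ)
    (AlgHom.ofLinearMap (actHom M ρ) (actHom_one M ρ) (actHom_mul M ρ)).toRingHom

theorem smul_def (u : Bismash k M) (w : M.Induced ρ) : u • w = actHom M ρ u w := rfl

open Classical in
theorem p_smul_tmul (y : G) (a b : F) (v : V) : Bismash.p k M y a • tmul M ρ b v =
    if M.act y (a * b) = x then tmul M ρ (a * b) v else 0 := by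
  rw [smul_def, actHom, Bismash.lift_p, pAct_tmul]

instance : IsScalarTower k (Bismash k M) (M.Induced ρ) where
  smul_assoc c u w := by simp [smul_def]

end Induced

end MatchedPair

end BismashDef

/-! ### The Hopf algebra `J_n` -/

section Jn

/-- The standard `n`-cycle `a = (1 2 ⋯ n)`, as a permutation of `ℤ/n = {1, …, n}`. -/
def cycle (n : ℕ) : Equiv.Perm (ZMod n) := Equiv.addRight 1

/-- The cyclic group `C_n = ⟨a⟩` inside `S_n`. -/
abbrev C (n : ℕ) : Subgroup (Equiv.Perm (ZMod n)) := Subgroup.zpowers (cycle n)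

/-- The generator `a` of `C_n`. -/
def gen (n : ℕ) : C n := ⟨cycle n, Subgroup.mem_zpowers _⟩

/-- The group `S_{n-1}`, as the subgroup of the permutations in `S_n` that fix `n`. -/
abbrev S (n : ℕ) : Subgroup (Equiv.Perm (ZMod n)) :=
  MulAction.stabilizer (Equiv.Perm (ZMod n)) ((n : ℕ) : ZMod n)

instance (n : ℕ) [NeZero n] : Fintype (S n) := Fintype.ofFinite _

theorem cycle_zpow_apply (n : ℕ) (r : ℤ) (u : ZMod n) : (cycle n ^ r) u = u + r := by
  simp [cycle]

theorem isComplement (n : ℕ) : (C n).IsComplement' (S n) := by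
  refine Subgroup.isComplement'_stabilizer _ ?_ ?_
  · rintro ⟨_, r, rfl⟩ h
    have h' : (cycle n ^ r) ((n : ℕ) : ZMod n) = ((n : ℕ) : ZMod n) := h
    rw [cycle_zpow_apply, add_eq_left] at h'
    ext u
    simp [cycle_zpow_apply, h']
  · intro g
    obtain ⟨r, hr⟩ := ZMod.intCast_surjective (g ((n : ℕ) : ZMod n))
    refine ⟨⟨cycle n ^ (-r), -r, rfl⟩, ?_⟩
    change (cycle n ^ (-r)) (g ((n : ℕ) : ZMod n)) = _
    rw [cycle_zpow_apply, ← hr]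
    simp

/-- The matched pair of the factorization `S_n = C_n S_{n-1}`. -/
def pair (n : ℕ) : MatchedPair (C n) (S n) := MatchedPair.ofComplement (isComplement n)

/-- The Hopf algebra `J_n = k^{S_{n-1}} # kC_n`. -/
abbrev J (k : Type*) [Field k] (n : ℕ) : Type _ := Bismash k (pair n)

end Jn

end FSInd

end

namespace FSInd

noncomputable section

open Module

namespace MatchedPair

variable {F G : Type*} [Group F] [Group G] (M : MatchedPair F G)

theorem mem_orbit_self (x : G) : x ∈ M.orbit x := ⟨1, M.act_one x⟩

theorem act_mem_orbit (x : G) (b : F) : M.act x b ∈ M.orbit x := ⟨b, rfl⟩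

variable {M}

theorem act_inv_of_act_eq {x y : G} {b : F} (h : M.act x b = y) : M.act y b⁻¹ = x := by
  rw [← h, ← M.act_mul, mul_inv_cancel, M.act_one]

theorem orbit_eq_of_mem {x y : G} (h : y ∈ M.orbit x) : M.orbit y = M.orbit x := by
  obtain ⟨d, rfl⟩ := h
  ext z
  constructor
  · rintro ⟨b, rfl⟩
    exact ⟨d * b, M.act_mul x d b⟩
  · rintro ⟨b, rfl⟩
    refine ⟨d⁻¹ * b, ?_⟩
    change M.act (M.act x d) (d⁻¹ * b) = M.act x b
    rw [← M.act_mul, mul_inv_cancel_left]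

theorem mem_orbit_symm {x y : G} (h : y ∈ M.orbit x) : x ∈ M.orbit y :=
  orbit_eq_of_mem h ▸ M.mem_orbit_self x

theorem stab_eq_of_mem_orbit [IsMulCommutative F] {x y : G} (h : y ∈ M.orbit x) :
    M.stab y = M.stab x := by
  obtain ⟨d, rfl⟩ := h
  ext f
  simp only [mem_stab]
  rw [← M.act_mul, mul_comm' d f, M.act_mul]
  exact ⟨M.act_inj, fun h => by rw [h]⟩

theorem tri_mem_stab_inv {x : G} {f : F} (hf : f ∈ M.stab x) : M.tri x f ∈ M.stab x⁻¹ := by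
  rw [mem_stab, ← M.inv_act, M.mem_stab.mp hf]

/-- If `x ◁ a = x⁻¹`, then `(x ▷ a) a` fixes `x`. -/
theorem tri_mul_self_mem_stab [IsMulCommutative F] {x : G} {a : F} (h : M.act x a = x⁻¹) :
    M.tri x a * a ∈ M.stab x := by
  have h' : M.act x⁻¹ (M.tri x a) = x := by rw [← M.inv_act, h, inv_inv]
  rw [mem_stab, mul_comm', M.act_mul, h, h']

/-- If `x ◁ a = x⁻¹`, then `x ▷ -` fixes `(x ▷ a) a`. -/
theorem tri_tri_mul_self [IsMulCommutative F] {x : G} {a : F} (h : M.act x a = x⁻¹) :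
    M.tri x (M.tri x a * a) = M.tri x a * a := by
  rw [mul_comm' (M.tri x a) a, M.tri_mul, h, ← M.mul_tri, inv_mul_cancel, M.one_tri, mul_comm']

theorem card_fiber [Fintype F] [DecidableEq G] {x y : G} (h : y ∈ M.orbit x) :
    (Finset.univ.filter fun c : F => M.act x c = y).card = Nat.card (M.stab x) := by
  classical
  obtain ⟨d, rfl⟩ := h
  rw [Nat.card_eq_fintype_card, Fintype.card_subtype]
  refine Finset.card_bij' (fun c _ => c * d⁻¹) (fun c _ => c * d) ?_ ?_ ?_ ?_
  · intro c hc
    have hc' : M.act x c = M.act x d := (Finset.mem_filter.mp hc).2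
    simp [mem_stab, M.act_mul, hc', ← M.act_mul x d, M.act_one]
  · intro c hc
    have hc' : M.act x c = x := (Finset.mem_filter.mp hc).2
    simp [M.act_mul, hc']
  · intro c _; simp
  · intro c _; simp

theorem sum_act_eq {k : Type*} [CommRing k] [Fintype F] [Fintype G] {x : G} {h : G → k}
    (hh : ∀ y ∉ M.orbit x, h y = 0) :
    ∑ c : F, h (M.act x c) = Nat.card (M.stab x) * ∑ y : G, h y := by
  classical
  rw [← Finset.sum_fiberwise_of_maps_to (s := Finset.univ) (t := Finset.univ)
    (g := fun c : F => M.act x c) (fun _ _ => Finset.mem_univ _), Finset.mul_sum]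
  refine Finset.sum_congr rfl fun y _ => ?_
  rw [Finset.sum_congr rfl (g := fun _ => h y) fun c hc => by rw [(Finset.mem_filter.mp hc).2],
    Finset.sum_const, nsmul_eq_mul]
  by_cases hy : y ∈ M.orbit x
  · rw [card_fiber hy]
  · rw [hh y hy, mul_zero, mul_zero]

theorem card_orbit_mul_card_stab [Fintype F] [Fintype G] (x : G) :
    Nat.card (M.orbit x) * Nat.card (M.stab x) = Fintype.card F := by
  classical
  have h := sum_act_eq (M := M) (k := ℤ) (x := x)
    (h := fun y => if y ∈ M.orbit x then 1 else 0) fun y hy => if_neg hy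
  simp only [M.act_mem_orbit, if_true, Finset.sum_const, Finset.card_univ, nsmul_eq_mul, mul_one,
    Finset.sum_boole] at h
  rw [Nat.card_eq_fintype_card (α := M.orbit x), Fintype.card_subtype, mul_comm]
  exact_mod_cast h.symm

/-- An orbit of odd size that meets its inverse contains an involution. -/
theorem exists_involution_of_odd [IsMulCommutative F] [Finite G] {x : G} {a : F}
    (h : M.act x a = x⁻¹) (hodd : Odd (Nat.card (M.orbit x))) :
    ∃ y ∈ M.orbit x, y * y = 1 := by
  classical
  have := Fintype.ofFinite G
  have hinv : ∀ y ∈ M.orbit x, y⁻¹ ∈ M.orbit x := by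
    rintro _ ⟨c, rfl⟩
    refine ⟨a * M.tri x c, ?_⟩
    change M.act x _ = (M.act x c)⁻¹
    rw [M.inv_act, M.act_mul, h]
  let σ : Equiv.Perm (M.orbit x) :=
    Function.Involutive.toPerm (fun y => ⟨(y : G)⁻¹, hinv y y.2⟩) fun y => by simp
  have hσ : σ ^ 2 ^ 1 = 1 := by
    ext y
    exact inv_inv (y : G)
  obtain ⟨y, hy⟩ := Equiv.Perm.exists_fixed_point_of_prime (p := 2)
    (by rw [← Nat.card_eq_fintype_card]; exact hodd.not_two_dvd_nat) hσ
  refine ⟨y, y.2, ?_⟩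
  have hy' : (y : G)⁻¹ = y := congrArg Subtype.val hy
  exact mul_eq_one_iff_inv_eq.mpr hy'

end MatchedPair

namespace Bismash

variable {k F G : Type*} [Field k] [Group F] [Group G] [Fintype G] {M : MatchedPair F G}

section Trace

variable (W : Type*) [AddCommGroup W] [Module k W] [Module (Bismash k M) W]
  [IsScalarTower k (Bismash k M) W]

variable (M) in
/-- The value of the character of `W` at `p_y # a`. -/
def pTrace (y : G) (a : F) : k := LinearMap.trace k W (Algebra.lsmul k k W (p k M y a))

theorem pTrace_act [IsMulCommutative F] {x : G} {f : F} (d : F) (hf : f ∈ M.stab x) :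
    pTrace (k := k) M W (M.act x d) f = pTrace M W x f := by
  have e₁ : p k M (M.act x d) f = p k M (M.act x d) d⁻¹ * p k M x (f * d) := by
    rw [p_mul_p, if_pos (M.act_inv_of_act_eq rfl).symm, mul_comm' f d, inv_mul_cancel_left]
  have e₂ : p k M x f = p k M x (f * d) * p k M (M.act x d) d⁻¹ := by
    rw [p_mul_p, M.act_mul, M.mem_stab.mp hf, if_pos rfl, mul_inv_cancel_right]
  rw [pTrace, pTrace, e₁, map_mul, LinearMap.trace_mul_comm, ← map_mul, ← e₂]

open Classical in
theorem indicator_eq_sum [Fintype F] [CharZero k] : indicator k (Bismash k M) W =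
    (Fintype.card F : k)⁻¹ * ∑ y : G, ∑ b : F,
      if M.act y b = y⁻¹ then pTrace M W y⁻¹ (M.tri y b * b) else 0 := by
  rw [indicator, normalizedIntegral_eq isNormalizedIntegral_haar, map_smul, map_smul, map_smul,
    map_smul, smul_eq_mul, map_sum, map_sum, map_sum, map_sum, Finset.sum_comm]
  congr 1
  refine Finset.sum_congr rfl fun b _ => ?_
  rw [comul_p, map_sum, map_sum, map_sum]
  refine Finset.sum_congr rfl fun y _ => ?_
  rw [LinearMap.mul'_apply, p_mul_p, one_mul, ← M.inv_act]
  by_cases h : M.act y b = y⁻¹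
  · rw [if_pos (by rw [h, inv_inv]), if_pos h, pTrace]
  · rw [if_neg fun h' => h (by rw [h', inv_inv, ← h']), if_neg h, map_zero, map_zero]

/-- `W` is supported on the orbit of `x`, and `p_x W` is one-dimensional. -/
structure IsConcentrated (k : Type*) {F G : Type*} [Field k] [Group F] [Group G] [Fintype G]
    (M : MatchedPair F G) (W : Type*) [AddCommGroup W] [Module k W] [Module (Bismash k M) W]
    (x : G) : Prop where
  finite : Module.Finite k W
  p_smul_eq_zero : ∀ y ∉ M.orbit x, ∀ w : W, p k M y 1 • w = 0
  exists_generator : ∃ w : W, w ≠ 0 ∧ p k M x 1 • w = w ∧ ∀ u : W, ∃ c : k, p k M x 1 • u = c • w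

variable {W}

namespace IsConcentrated

variable {x : G} (h : IsConcentrated k M W x)

include h

theorem pTrace_eq_zero {y : G} (hy : y ∉ M.orbit x) (a : F) : pTrace (k := k) M W y a = 0 := by
  have e : p k M y a = p k M y 1 * p k M y a := by simp [p_mul_p, M.act_one]
  have : Algebra.lsmul k k W (p k M y a) = 0 := by
    ext w
    change p k M y a • w = 0
    rw [e, mul_smul, h.p_smul_eq_zero y hy]
  rw [pTrace, this, map_zero]

theorem lsmul_p_eq {f : F} (hf : f ∈ M.stab x) : Algebra.lsmul k k W (p k M x f) =
    pTrace (k := k) M W x f • Algebra.lsmul k k W (p k M x 1) ∧ pTrace (k := k) M W x 1 = 1 := by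
  have := h.finite
  obtain ⟨w, hw0, hw, hu⟩ := h.exists_generator
  choose c hc using hu
  let φ : W →ₗ[k] k :=
    { toFun := c
      map_add' u v := smul_left_injective k hw0 (by
        simp only [add_smul, ← hc, smul_add])
      map_smul' r u := smul_left_injective k hw0 (by
        simp only [RingHom.id_apply, smul_assoc, ← hc, smul_comm r])}
  have h1 : Algebra.lsmul k k W (p k M x 1) = φ.smulRight w := by
    ext u; exact hc u
  have hφ : φ w = 1 := smul_left_injective k hw0 (by
    change c w • w = (1 : k) • w
    rw [← hc, hw, one_smul])
  have ht : pTrace (k := k) M W x 1 = 1 := by rw [pTrace, h1, LinearMap.trace_smulRight, hφ]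
  refine ⟨?_, ht⟩
  have e₁ : p k M x f = p k M x 1 * p k M x f := by simp [p_mul_p, M.act_one]
  have e₂ : p k M x f = p k M x f * p k M x 1 := by simp [p_mul_p, M.mem_stab.mp hf]
  have h2 : Algebra.lsmul k k W (p k M x f) =
      c (p k M x f • w) • Algebra.lsmul k k W (p k M x 1) := by
    ext u
    change p k M x f • u = c (p k M x f • w) • p k M x 1 • u
    have hw' : p k M x f • w = c (p k M x f • w) • w := by rw [← hc, ← mul_smul, ← e₁]
    rw [hc u, smul_comm, ← hw', ← smul_comm, ← hc, ← mul_smul, ← e₂]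
  rw [pTrace, h2, map_smul, ← pTrace, ht, smul_eq_mul, mul_one]

theorem pTrace_one : pTrace (k := k) M W x 1 = 1 := (h.lsmul_p_eq (M.stab x).one_mem).2

theorem pTrace_mul {f g : F} (hf : f ∈ M.stab x) (hg : g ∈ M.stab x) :
    pTrace (k := k) M W x (f * g) = pTrace M W x f * pTrace M W x g := by
  have e : p k M x (f * g) = p k M x f * p k M x g := by simp [p_mul_p, M.mem_stab.mp hf]
  have e' : p k M x 1 * p k M x 1 = p k M x 1 := by simp [p_mul_p, M.act_one]
  rw [pTrace, e, map_mul, (h.lsmul_p_eq hf).1, (h.lsmul_p_eq hg).1, smul_mul_smul_comm, ← map_mul,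
    e', map_smul, ← pTrace, h.pTrace_one, smul_eq_mul, mul_one]

/-- The character by which the stabilizer of `x` acts on `p_x W`. -/
def char : M.stab x →* k where
  toFun f := pTrace M W x (f : F)
  map_one' := h.pTrace_one
  map_mul' f g := h.pTrace_mul f.2 g.2

theorem of_mem_orbit {y : G} (hy : y ∈ M.orbit x) : IsConcentrated k M W y where
  finite := h.finite
  p_smul_eq_zero z hz := h.p_smul_eq_zero z (by rwa [← M.orbit_eq_of_mem hy])
  exists_generator := by
    obtain ⟨w, hw0, hw, hu⟩ := h.exists_generator
    obtain ⟨d, rfl⟩ := hy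
    have hd : M.act (M.act x d) d⁻¹ = x := M.act_inv_of_act_eq rfl
    have e₁ : p k M (M.act x d) d⁻¹ * p k M x d = p k M (M.act x d) 1 := by simp [p_mul_p, hd]
    have e₂ : p k M x d * p k M (M.act x d) d⁻¹ = p k M x 1 := by simp [p_mul_p]
    have e₃ : p k M (M.act x d) 1 * p k M (M.act x d) d⁻¹ = p k M (M.act x d) d⁻¹ := by
      simp [p_mul_p, M.act_one]
    have e₄ : p k M x d = p k M x 1 * p k M x d := by simp [p_mul_p, M.act_one]
    refine ⟨p k M (M.act x d) d⁻¹ • w, fun h0 => hw0 ?_, ?_, fun u => ?_⟩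
    · rw [← hw, ← e₂, mul_smul, h0, smul_zero]
    · rw [← mul_smul, e₃]
    · obtain ⟨c, hc⟩ := hu (p k M x d • u)
      refine ⟨c, ?_⟩
      change p k M (M.act x d) 1 • u = _
      rw [← e₁, mul_smul, e₄, mul_smul, hc, smul_comm]

end IsConcentrated

end Trace

end Bismash

namespace MatchedPair

variable {F G : Type*} [Group F] [Group G] {M : MatchedPair F G}

/-- Substituting `b = c⁻¹ a (x ▷ c)` moves `y ◁ b = y⁻¹` from `y = x ◁ c` to `x`. -/
theorem act_act_eq_inv_iff [IsMulCommutative F] (x : G) (a c : F) :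
    M.act (M.act x c) (c⁻¹ * (a * M.tri x c)) = (M.act x c)⁻¹ ↔ M.act x a = x⁻¹ := by
  rw [← M.act_mul, mul_inv_cancel_left, M.act_mul, M.inv_act]
  exact ⟨M.act_inj, fun h => by rw [h]⟩

open scoped IsMulCommutative in
theorem tri_act_mul [IsMulCommutative F] {x : G} {a : F} (c : F) (h : M.act x a = x⁻¹) :
    M.tri (M.act x c) (c⁻¹ * (a * M.tri x c)) * (c⁻¹ * (a * M.tri x c)) = M.tri x a * a := by
  have e := M.tri_mul x c (c⁻¹ * (a * M.tri x c))
  rw [mul_inv_cancel_left, M.tri_mul, h, ← M.mul_tri, inv_mul_cancel, M.one_tri] at e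
  rw [eq_inv_mul_of_mul_eq e.symm, mul_assoc (M.tri x c)⁻¹, mul_assoc (M.tri x a) c,
    mul_inv_cancel_left, ← mul_assoc (M.tri x a), mul_comm (M.tri x c)⁻¹, mul_inv_cancel_right]

open scoped IsMulCommutative in
theorem tri_mul_mul [IsMulCommutative F] {x : G} {f : F} (a : F) (hf : f ∈ M.stab x) :
    M.tri x (f * a) * (f * a) = M.tri x a * a * (M.tri x f * f) := by
  rw [M.tri_mul, M.mem_stab.mp hf, mul_mul_mul_comm, mul_comm]

theorem tri_mem_stab [IsMulCommutative F] {x : G} {f a : F} (ha : M.act x a = x⁻¹)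
    (hf : f ∈ M.stab x) :
    M.tri x f ∈ M.stab x := by
  have := M.tri_mem_stab_inv hf
  rwa [M.stab_eq_of_mem_orbit (ha ▸ M.act_mem_orbit x a : x⁻¹ ∈ M.orbit x)] at this

end MatchedPair

namespace Bismash

namespace IsConcentrated

variable {k F G : Type*} [Field k] [Group F] [Group G] [Fintype G] {M : MatchedPair F G}
variable {W : Type*} [AddCommGroup W] [Module k W] [Module (Bismash k M) W]
  [IsScalarTower k (Bismash k M) W] [Fintype F] [CharZero k] {x : G}

theorem indicator_eq_zero (h : IsConcentrated k M W x)
    (hx : ∀ y ∈ M.orbit x, y⁻¹ ∉ M.orbit x) : indicator k (Bismash k M) W = 0 := by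
  classical
  rw [indicator_eq_sum, Finset.sum_eq_zero, mul_zero]
  intro y _
  refine Finset.sum_eq_zero fun b _ => ?_
  split_ifs with hb
  · by_cases hy : y⁻¹ ∈ M.orbit x
    · refine absurd hy (hx y ?_)
      rw [← M.orbit_eq_of_mem hy]
      exact M.mem_orbit_symm (hb ▸ M.act_mem_orbit y b)
    · exact h.pTrace_eq_zero hy _
  · rfl

variable [IsMulCommutative F]

theorem indicator_eq (h : IsConcentrated k M W x) {a : F} (ha : M.act x a = x⁻¹) :
    indicator k (Bismash k M) W = pTrace M W x (M.tri x a * a) *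
      ((Nat.card (M.stab x) : k)⁻¹ * ∑ᶠ f : M.stab x, pTrace M W x (M.tri x f * f)) := by
  classical
  let g : G → k := fun y => ∑ b : F,
    if M.act y b = y⁻¹ then pTrace M W y⁻¹ (M.tri y b * b) else 0
  have hstab : (Nat.card (M.stab x) : k) ≠ 0 := Nat.cast_ne_zero.mpr Nat.card_pos.ne'
  have hF : (Fintype.card F : k) ≠ 0 := Nat.cast_ne_zero.mpr Fintype.card_ne_zero
  have hg0 : ∀ y ∉ M.orbit x, g y = 0 := by
    intro y hy
    refine Finset.sum_eq_zero fun b _ => ?_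
    split_ifs with hb
    · refine h.pTrace_eq_zero (fun hy' => hy ?_) _
      rw [← M.orbit_eq_of_mem hy']
      exact M.mem_orbit_symm (hb ▸ M.act_mem_orbit y b)
    · rfl
  have hg : ∀ c : F, g (M.act x c) = g x := by
    intro c
    refine (Fintype.sum_equiv ((Equiv.mulRight (M.tri x c)).trans (Equiv.mulLeft c⁻¹)) _ _
      fun b => ?_).symm
    change _ = if M.act (M.act x c) (c⁻¹ * (b * M.tri x c)) = (M.act x c)⁻¹ then
      pTrace M W (M.act x c)⁻¹ (M.tri (M.act x c) (c⁻¹ * (b * M.tri x c)) *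
        (c⁻¹ * (b * M.tri x c))) else 0
    rw [M.act_act_eq_inv_iff]
    split_ifs with hb
    · rw [M.tri_act_mul c hb, M.inv_act, ← hb, ← M.act_mul, pTrace_act W _
        (M.tri_mul_self_mem_stab hb), pTrace_act W _ (M.tri_mul_self_mem_stab hb)]
    · rfl
  have hsum := M.sum_act_eq hg0
  rw [Finset.sum_congr rfl fun c _ => hg c, Finset.sum_const, Finset.card_univ,
    nsmul_eq_mul] at hsum
  have hgx : g x = pTrace M W x (M.tri x a * a) *
      ∑ᶠ f : M.stab x, pTrace M W x (M.tri x f * f) := by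
    rw [finsum_eq_sum_of_fintype, Finset.mul_sum,
      ← Finset.sum_subtype (Finset.univ.filter (· ∈ M.stab x)) (by simp) fun f : F => pTrace (k := k) M W x (M.tri x a * a) *
        pTrace M W x (M.tri x f * f), Finset.sum_filter]
    refine (Fintype.sum_equiv (Equiv.mulRight a) _ _ fun f => ?_).symm
    change _ = if M.act x (f * a) = x⁻¹ then
      pTrace M W x⁻¹ (M.tri x (f * a) * (f * a)) else 0
    have hiff : M.act x (f * a) = x⁻¹ ↔ f ∈ M.stab x := by
      rw [← ha, M.act_mul, M.mem_stab]
      exact ⟨M.act_inj, fun h => by rw [h]⟩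
    rw [if_congr hiff rfl rfl]
    split_ifs with hf
    · have hm := M.tri_mul_self_mem_stab ha
      have hm' := (M.stab x).mul_mem (M.tri_mem_stab ha hf) hf
      rw [M.tri_mul_mul a hf, ← h.pTrace_mul hm hm', ← ha,
        pTrace_act W a ((M.stab x).mul_mem hm hm')]
    · rfl
  rw [indicator_eq_sum, inv_mul_eq_iff_eq_mul₀ hF]
  change ∑ y, g y = _
  apply mul_left_cancel₀ hstab
  rw [← hsum, hgx]
  field_simp

theorem indicator_eq_zero_or (h : IsConcentrated k M W x) {a : F} (ha : M.act x a = x⁻¹) :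
    indicator k (Bismash k M) W = 0 ∨
      indicator k (Bismash k M) W = pTrace M W x (M.tri x a * a) ∧
        pTrace (k := k) M W x (M.tri x a * a) ^ 2 = 1 := by
  classical
  let θ : M.stab x →* k :=
    { toFun f := pTrace M W x (M.tri x f * f)
      map_one' := by
        rw [Subgroup.coe_one, M.tri_one, one_mul, h.pTrace_one]
      map_mul' f g := by
        rw [mul_comm' f g, Subgroup.coe_mul, M.tri_mul_mul _ g.2]
        exact h.pTrace_mul ((M.stab x).mul_mem (M.tri_mem_stab ha f.2) f.2)
          ((M.stab x).mul_mem (M.tri_mem_stab ha g.2) g.2) }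
  have hθ : ∀ f : M.stab x, pTrace (k := k) M W x (M.tri x f * f) = θ f := fun _ => rfl
  by_cases h1 : θ = 1
  · right
    constructor
    · have hstab : (Nat.card (M.stab x) : k) ≠ 0 := Nat.cast_ne_zero.mpr Nat.card_pos.ne'
      rw [h.indicator_eq ha]
      simp only [hθ, finsum_eq_sum_of_fintype, h1, MonoidHom.one_apply, Finset.sum_const, Finset.card_univ,
        nsmul_eq_mul, mul_one, ← Nat.card_eq_fintype_card, inv_mul_cancel₀ hstab]
    · have hm := M.tri_mul_self_mem_stab ha
      rw [pow_two, ← h.pTrace_mul hm hm]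
      have := DFunLike.congr_fun h1 ⟨_, hm⟩
      rwa [← hθ, M.tri_tri_mul_self ha] at this
  · left
    rw [h.indicator_eq ha]
    simp only [hθ, finsum_eq_sum_of_fintype, sum_hom_units_eq_zero θ h1, mul_zero]

/-- The indicator is `0` or `1` if the orbit or the stabilizer has odd order, or if the orbit
contains an involution. -/
theorem indicator_eq_zero_or_one (h : IsConcentrated k M W x)
    (hx : Odd (Nat.card (M.orbit x)) ∨ Odd (Nat.card (M.stab x)) ∨ ∃ y ∈ M.orbit x, y * y = 1) :
    indicator k (Bismash k M) W = 0 ∨ indicator k (Bismash k M) W = 1 := by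
  by_cases hex : ∃ y ∈ M.orbit x, y⁻¹ ∈ M.orbit x
  swap
  · push Not at hex
    exact Or.inl (h.indicator_eq_zero hex)
  obtain ⟨z, hz, hz'⟩ := hex
  have involution : (∃ y ∈ M.orbit x, y * y = 1) →
      indicator k (Bismash k M) W = 0 ∨ indicator k (Bismash k M) W = 1 := by
    rintro ⟨y, hy, hyy⟩
    have hy1 : M.act y 1 = y⁻¹ := by rw [M.act_one, ← eq_inv_of_mul_eq_one_left hyy]
    refine ((h.of_mem_orbit hy).indicator_eq_zero_or hy1).imp_right fun h' => ?_
    rw [h'.1, M.tri_one, one_mul, (h.of_mem_orbit hy).pTrace_one]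
  have hzx := M.orbit_eq_of_mem hz
  rw [← hzx] at hz'
  obtain ⟨a, ha⟩ := hz'
  change M.act z a = z⁻¹ at ha
  rcases hx with hodd | hodd | hinv
  · refine involution ?_
    rw [← hzx] at hodd ⊢
    exact M.exists_involution_of_odd ha hodd
  · have hc := h.of_mem_orbit hz
    refine (hc.indicator_eq_zero_or ha).imp_right fun h' => h'.1.trans ?_
    have hm := M.tri_mul_self_mem_stab ha
    rw [← M.stab_eq_of_mem_orbit hz] at hodd
    have hpow : hc.char ⟨_, hm⟩ ^ Nat.card (M.stab z) = 1 := by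
      rw [← map_pow, pow_card_eq_one', map_one]
    have hsq : hc.char ⟨_, hm⟩ ^ 2 = 1 := h'.2
    have := orderOf_dvd_of_pow_eq_one hpow
    have h2 := orderOf_dvd_of_pow_eq_one hsq
    have h1 := Nat.dvd_gcd this h2
    rw [Nat.coprime_two_right.mpr hodd] at h1
    exact orderOf_eq_one_iff.mp (Nat.dvd_one.mp h1)
  · exact involution hinv

end IsConcentrated

end Bismash

/-- Isomorphic modules have the same indicator. -/
theorem indicator_congr {k H : Type*} [Field k] [Ring H] [HopfAlgebra k H]
    {V W : Type*} [AddCommGroup V] [Module k V] [Module H V] [IsScalarTower k H V]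
    [AddCommGroup W] [Module k W] [Module H W] [IsScalarTower k H W] (e : V ≃ₗ[k] W)
    (he : ∀ (u : H) (v : V), e (u • v) = u • e v) : indicator k H V = indicator k H W := by
  rw [indicator, indicator, ← LinearMap.trace_conj' _ e]
  congr 1
  ext w
  exact (he _ (e.symm w)).trans (congrArg _ (e.apply_symm_apply w))

namespace MatchedPair

namespace Induced

variable {k F G : Type*} [Field k] [Group F] [Group G] {M : MatchedPair F G}
variable {x y : G} {V : Type*} [AddCommGroup V] [Module k V]

theorem induction {ρ : Representation k (M.stab x) V} {P : M.Induced ρ → Prop} (u : M.Induced ρ)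
    (tmul : ∀ b v, P (tmul M ρ b v)) (add : ∀ u v, P u → P v → P (u + v)) : P u := by
  obtain ⟨u, rfl⟩ := Submodule.mkQ_surjective _ u
  induction u using Finsupp.induction_linear with
  | zero =>
    have h := tmul 1 0
    rwa [map_zero] at h
  | add u v hu hv => rw [map_add]; exact add _ _ hu hv
  | single b v => exact tmul b v

/-- The linear map with prescribed values on the elements `b ⊗ v`. -/
def lift {N : Type*} [AddCommGroup N] [Module k N] (ρ : Representation k (M.stab x) V)
    (f : F → V →ₗ[k] N) (hf : ∀ (b : F) (c : M.stab x) (v : V), f (b * c) v = f b (ρ c v)) :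
    M.Induced ρ →ₗ[k] N :=
  (M.inducedRel ρ).liftQ (Finsupp.lsum k f) <| by
    rw [inducedRel, Submodule.span_le]
    rintro _ ⟨b, c, v, rfl⟩
    rw [SetLike.mem_coe, LinearMap.mem_ker, map_sub, Finsupp.lsum_single, Finsupp.lsum_single,
      hf, sub_self]

theorem lift_tmul {N : Type*} [AddCommGroup N] [Module k N] (ρ : Representation k (M.stab x) V)
    (f : F → V →ₗ[k] N) (hf : ∀ (b : F) (c : M.stab x) (v : V), f (b * c) v = f b (ρ c v))
    (b : F) (v : V) : lift ρ f hf (tmul M ρ b v) = f b v :=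
  Finsupp.lsum_single k f b v

theorem tmul_one_injective (ρ : Representation k (M.stab x) V) :
    Function.Injective (tmul M ρ 1) := by
  classical
  let f : F → V →ₗ[k] V := fun b => if hb : b ∈ M.stab x then ρ ⟨b, hb⟩ else 0
  have hf : ∀ (b : F) (c : M.stab x) (v : V), f (b * c) v = f b (ρ c v) := by
    intro b c v
    by_cases hb : b ∈ M.stab x
    · have hbc : b * c ∈ M.stab x := (M.stab x).mul_mem hb c.2
      have e : (⟨b * c, hbc⟩ : M.stab x) = ⟨b, hb⟩ * c := rfl
      simp only [f, dif_pos hb, dif_pos hbc, e, map_mul, Module.End.mul_apply]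
    · have hbc : b * c ∉ M.stab x := fun h => hb (((M.stab x).mul_mem_cancel_right c.2).mp h)
      simp only [f, dif_neg hb, dif_neg hbc, LinearMap.zero_apply]
  refine Function.LeftInverse.injective (g := lift ρ f hf) fun v => ?_
  have e : (⟨1, (M.stab x).one_mem⟩ : M.stab x) = 1 := rfl
  rw [lift_tmul]
  simp only [f, dif_pos (M.stab x).one_mem, e, map_one, Module.End.one_apply]

open scoped IsMulCommutative in
/-- The map `b ⊗ v ↦ bd ⊗ v`. -/
def shift [IsMulCommutative F] (ρ : Representation k (M.stab x) V)
    (σ : Representation k (M.stab y) V) (d : F) (hd : M.act x d = y)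
    (h : ∀ (b : M.stab x) (c : M.stab y), (b : F) = c → ρ b = σ c) :
    M.Induced ρ →ₗ[k] M.Induced σ :=
  lift ρ (fun b => tmul M σ (b * d)) fun b c v => by
    have hc : (c : F) ∈ M.stab y := by
      rw [M.stab_eq_of_mem_orbit (hd ▸ M.act_mem_orbit x d : y ∈ M.orbit x)]
      exact c.2
    rw [h c ⟨c, hc⟩ rfl, ← tmul_smul, mul_right_comm]

theorem shift_tmul [IsMulCommutative F] (ρ : Representation k (M.stab x) V)
    (σ : Representation k (M.stab y) V) (d : F) (hd : M.act x d = y)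
    (h : ∀ (b : M.stab x) (c : M.stab y), (b : F) = c → ρ b = σ c) (b : F) (v : V) :
    shift ρ σ d hd h (tmul M ρ b v) = tmul M σ (b * d) v :=
  lift_tmul ..

theorem indicator_eq_of_mem_orbit [Fintype G] [IsMulCommutative F]
    (ρ : Representation k (M.stab x) V)
    (σ : Representation k (M.stab y) V) (hy : y ∈ M.orbit x)
    (h : ∀ (b : M.stab x) (c : M.stab y), (b : F) = c → ρ b = σ c) :
    indicator k (Bismash k M) (M.Induced ρ) = indicator k (Bismash k M) (M.Induced σ) := by
  classical
  obtain ⟨d, hd⟩ := hy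
  change M.act x d = y at hd
  let e : M.Induced ρ ≃ₗ[k] M.Induced σ := LinearEquiv.ofLinearMap (shift ρ σ d hd h)
    (shift σ ρ d⁻¹ (M.act_inv_of_act_eq hd) fun b c hbc => (h c b hbc.symm).symm)
    (hom_ext fun b v => by simp [shift_tmul]) (hom_ext fun b v => by simp [shift_tmul])
  have he : ∀ b v, e (tmul M ρ b v) = tmul M σ (b * d) v := shift_tmul ρ σ d hd h
  refine indicator_congr e fun u w => ?_
  induction u using Bismash.induction with
  | hadd u u' h h' => simp only [add_smul, map_add, h, h']
  | hsmul c u h => simp only [smul_assoc, map_smul, h]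
  | hp z a =>
  induction w using induction with
  | add w w' h h' => simp only [smul_add, map_add, h, h']
  | tmul b v =>
  have hiff : M.act z (a * (b * d)) = y ↔ M.act z (a * b) = x := by
    rw [← mul_assoc, M.act_mul, ← hd]
    exact ⟨M.act_inj, fun h => by rw [h]⟩
  rw [he, p_smul_tmul, p_smul_tmul, if_congr hiff rfl rfl, apply_ite e, he, map_zero, mul_assoc]

theorem finrank_eq_one [Finite F] [IsMulCommutative F] [IsAlgClosed k]
    (ρ : Representation k (M.stab x) V) [ρ.IsIrreducible] : finrank k V = 1 := by
  have : IsMulCommutative (M.stab x) := inferInstance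
  have : Module.Finite k ρ.asModule := Module.Finite.trans (MonoidAlgebra k (M.stab x)) ρ.asModule
  have : Module.Finite k V := this
  exact Representation.IsIrreducible.finrank_eq_one_of_isMulCommutative ρ

theorem isConcentrated [Fintype G] [Finite F] [IsMulCommutative F] [IsAlgClosed k]
    (ρ : Representation k (M.stab x) V) [ρ.IsIrreducible] :
    Bismash.IsConcentrated k M (M.Induced ρ) x where
  finite := by
    have : Module.Finite k V := Module.finite_of_finrank_eq_succ (finrank_eq_one ρ)
    exact inferInstanceAs (Module.Finite k ((F →₀ V) ⧸ M.inducedRel ρ))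
  p_smul_eq_zero y hy w := by
    induction w using induction with
    | add u v hu hv => rw [smul_add, hu, hv, add_zero]
    | tmul b v =>
    rw [p_smul_tmul, if_neg]
    rw [one_mul]
    exact fun h => hy (M.mem_orbit_symm (h ▸ M.act_mem_orbit y b))
  exists_generator := by
    obtain ⟨v, hv0, hv⟩ := finrank_eq_one_iff'.mp (finrank_eq_one ρ)
    refine ⟨tmul M ρ 1 v, fun h => hv0 (tmul_one_injective ρ (h.trans (map_zero _).symm)), ?_, ?_⟩
    · rw [p_smul_tmul, mul_one, if_pos (M.act_one x)]
    · intro u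
      induction u using induction with
      | add u u' h h' =>
        obtain ⟨c, hc⟩ := h
        obtain ⟨c', hc'⟩ := h'
        exact ⟨c + c', by rw [smul_add, hc, hc', add_smul]⟩
      | tmul b u =>
      rw [p_smul_tmul, one_mul]
      by_cases hb : M.act x b = x
      · obtain ⟨c, hc⟩ := hv (ρ ⟨b, hb⟩ u)
        refine ⟨c, ?_⟩
        have e := tmul_smul M ρ 1 ⟨b, hb⟩ u
        rw [one_mul] at e
        rw [if_pos hb, e, ← hc, map_smul]
      · exact ⟨0, by rw [if_neg hb, zero_smul]⟩

end Induced

end MatchedPair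

namespace Bismash

variable {k F G : Type*} [Field k] [Group F] [Group G] [Fintype G] {M : MatchedPair F G}

instance [Finite F] : Module.Finite k (Bismash k M) := Module.Finite.of_basis (basis k M)

theorem exists_isConcentrated [IsAlgClosed k] [Finite F] [IsCyclic F] (W : Type*) [AddCommGroup W]
    [Module k W] [Module (Bismash k M) W] [IsScalarTower k (Bismash k M) W]
    [IsSimpleModule (Bismash k M) W] : ∃ x, IsConcentrated k M W x := by
  classical
  have : Module.Finite k W := Module.Finite.trans (Bismash k M) W
  have : Nontrivial W := IsSimpleModule.nontrivial (Bismash k M) W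
  obtain ⟨x, u, hxu⟩ : ∃ (x : G) (u : W), p k M x 1 • u ≠ 0 := by
    by_contra! hex
    obtain ⟨u, hu⟩ := exists_ne (0 : W)
    refine hu ?_
    rw [← one_smul (Bismash k M) u, one_def, Finset.sum_smul]
    exact Finset.sum_eq_zero fun x _ => hex x u
  obtain ⟨⟨g, hg⟩, hgen⟩ := IsCyclic.exists_generator (α := M.stab x)
  have e₁ : ∀ a, p k M x 1 * p k M x a = p k M x a := fun a => by simp [p_mul_p, M.act_one]
  let P := LinearMap.range (Algebra.lsmul k k W (p k M x 1))
  have hP : ∀ w ∈ P, Algebra.lsmul k k W (p k M x g) w ∈ P := fun w _ =>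
    ⟨p k M x g • w, by
      change p k M x 1 • p k M x g • w = p k M x g • w
      rw [← mul_smul, e₁]⟩
  have : Nontrivial P := ⟨⟨⟨_, u, rfl⟩, 0, fun h => hxu (congrArg Subtype.val h)⟩⟩
  obtain ⟨μ, hμ⟩ := Module.End.exists_eigenvalue ((Algebra.lsmul k k W (p k M x g)).restrict hP)
  obtain ⟨⟨w, hwP⟩, hw⟩ := hμ.exists_hasEigenvector
  have hw0 : w ≠ 0 := fun h => hw.2 (Subtype.ext h)
  have hgw : p k M x g • w = μ • w := congrArg Subtype.val hw.apply_eq_smul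
  have hw1 : p k M x 1 • w = w := by
    obtain ⟨v, rfl⟩ := hwP
    change p k M x 1 • p k M x 1 • v = p k M x 1 • v
    rw [← mul_smul, e₁]
  have hpow : ∀ i : ℕ, p k M x (g ^ i) • w = μ ^ i • w := by
    intro i
    induction i with
    | zero => rw [pow_zero, pow_zero, one_smul, hw1]
    | succ i ih =>
      have e : p k M x (g ^ (i + 1)) = p k M x g * p k M x (g ^ i) := by
        rw [p_mul_p, M.mem_stab.mp hg, if_pos rfl, pow_succ']
      rw [e, mul_smul, ih, smul_comm, hgw, smul_smul, pow_succ]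
  have hstab : ∀ f ∈ M.stab x, ∃ c : k, p k M x f • w = c • w := by
    intro f hf
    obtain ⟨i, hi⟩ := mem_powers_iff_mem_zpowers.mpr (hgen ⟨f, hf⟩)
    exact ⟨μ ^ i, by rw [← hpow i, show f = g ^ i from (congrArg Subtype.val hi).symm]⟩
  have hpw : ∀ z b, x ≠ M.act z b → p k M z b • w = 0 := by
    intro z b hzb
    rw [← hw1, ← mul_smul, p_mul_p, if_neg hzb, zero_smul]
  refine ⟨x, inferInstance, fun y hy v => ?_, w, hw0, hw1, fun v => ?_⟩
  · obtain ⟨j, rfl⟩ := IsSimpleModule.toSpanSingleton_surjective (Bismash k M) hw0 v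
    change p k M y 1 • j • w = 0
    induction j using induction with
    | hadd j j' h h' => rw [add_smul, smul_add, h, h', add_zero]
    | hsmul c j h => rw [smul_assoc, smul_comm, h, smul_zero]
    | hp z b =>
    rw [← mul_smul, p_mul_p, M.act_one, one_mul]
    split_ifs with hz
    · exact hpw y b fun h => hy (M.mem_orbit_symm (h ▸ M.act_mem_orbit y b))
    · exact zero_smul _ _
  · obtain ⟨j, rfl⟩ := IsSimpleModule.toSpanSingleton_surjective (Bismash k M) hw0 v
    change ∃ c : k, p k M x 1 • j • w = c • w
    induction j using induction with
    | hadd j j' h h' =>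
      obtain ⟨c, hc⟩ := h
      obtain ⟨c', hc'⟩ := h'
      exact ⟨c + c', by rw [add_smul, smul_add, hc, hc', add_smul]⟩
    | hsmul r j h =>
      obtain ⟨c, hc⟩ := h
      exact ⟨r * c, by rw [smul_assoc, smul_comm, hc, smul_smul]⟩
    | hp z b =>
    rw [← mul_smul, p_mul_p, M.act_one, one_mul]
    split_ifs with hz
    · by_cases hb : x = M.act x b
      · exact hstab b hb.symm
      · exact ⟨0, by rw [hpw x b hb, zero_smul]⟩
    · exact ⟨0, by rw [zero_smul, zero_smul]⟩

end Bismash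

section Cyclic

variable (n : ℕ)

theorem orderOf_cycle : orderOf (cycle n) = n := by
  have h : ∀ m : ℕ, cycle n ^ m = 1 ↔ n ∣ m := by
    intro m
    rw [← zpow_natCast, ← ZMod.natCast_eq_zero_iff]
    constructor
    · intro h
      have := DFunLike.congr_fun h (0 : ZMod n)
      rw [cycle_zpow_apply] at this
      simpa using this
    · intro h
      ext u
      rw [cycle_zpow_apply]
      simp [h]
  exact Nat.dvd_antisymm (orderOf_dvd_of_pow_eq_one ((h n).mpr dvd_rfl))
    ((h _).mp (pow_orderOf_eq_one _))

theorem card_C : Nat.card (C n) = n := by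
  rw [Nat.card_zpowers, orderOf_cycle]

theorem card_zpowers_gen_pow [NeZero n] {t : ℕ} (ht : t ∣ n) :
    Nat.card (Subgroup.zpowers (gen n ^ t)) = n / t := by
  have hgen : orderOf (gen n) = n := by rw [gen, Subgroup.orderOf_mk, orderOf_cycle]
  have ht0 : t ≠ 0 := fun h => NeZero.ne n (by rwa [h, zero_dvd_iff] at ht)
  rw [Nat.card_zpowers, orderOf_pow_of_dvd ht0 (by rwa [hgen]), hgen]

variable {n}

theorem card_orbit_mul_card_stab_pair [NeZero n] (x : S n) :
    Nat.card ((pair n).orbit x) * Nat.card ((pair n).stab x) = n := by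
  have := Fintype.ofFinite (C n)
  rw [MatchedPair.card_orbit_mul_card_stab, ← Nat.card_eq_fintype_card, card_C]

theorem odd_orbit_or_odd_stab [NeZero n] (hn : Odd n ∨ ∃ m : ℕ, Odd m ∧ n = 2 * m) (x : S n) :
    Odd (Nat.card ((pair n).orbit x)) ∨ Odd (Nat.card ((pair n).stab x)) := by
  have h := card_orbit_mul_card_stab_pair x
  by_contra! hne
  simp only [Nat.not_odd_iff_even] at hne
  obtain ⟨⟨a, ha⟩, ⟨b, hb⟩⟩ := hne
  rw [ha, hb] at h
  have h4 : n = 2 * (2 * (a * b)) := by rw [← h]; ring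
  rcases hn with ⟨c, hc⟩ | ⟨m, ⟨c, hc⟩, hm⟩ <;> omega

theorem odd_orbit_of_stab_eq [NeZero n] {x : S n} {t : ℕ} (ht : t ∣ n)
    (hx : (pair n).stab x = Subgroup.zpowers (gen n ^ t)) (hodd : Odd t) :
    Odd (Nat.card ((pair n).orbit x)) := by
  have h := card_orbit_mul_card_stab_pair x
  rw [hx, card_zpowers_gen_pow n ht] at h
  have h0 : 0 < n / t := Nat.div_pos (Nat.le_of_dvd (NeZero.pos n) ht)
    (Nat.pos_of_dvd_of_pos ht (NeZero.pos n))
  rwa [Nat.eq_of_mul_eq_mul_right h0 (h.trans (Nat.mul_div_cancel' ht).symm)]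

end Cyclic

end

end FSInd

theorem mainTheorem2 {k : Type*} [Field k] [IsAlgClosed k] [CharZero k] (n : ℕ) [NeZero n] :
    -- every irreducible representation of `J_n` has indicator `0` or `1` if `n` is odd, and also
    -- if `n` is twice an odd number
    (Odd n ∨ (∃ m : ℕ, Odd m ∧ n = 2 * m) →
      ∀ (W : Type*) [AddCommGroup W] [Module k W] [Module (FSInd.J k n) W]
        [IsScalarTower k (FSInd.J k n) W] [IsSimpleModule (FSInd.J k n) W],
        FSInd.indicator k (FSInd.J k n) W = 0 ∨ FSInd.indicator k (FSInd.J k n) W = 1) ∧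
    -- the modules induced from the irreducible representations of `F_x = ⟨a^t⟩`
    (∀ (x : FSInd.S n) (t : ℕ), t ∣ n →
      (FSInd.pair n).stab x = Subgroup.zpowers (FSInd.gen n ^ t) →
      (Odd t ∨ (∃ y ∈ (FSInd.pair n).orbit x, y * y = 1) ∨ (∃ m : ℕ, Odd m ∧ n = 2 * m)) →
      ∀ (V : Type*) [AddCommGroup V] [Module k V]
        (ρ : Representation k ((FSInd.pair n).stab x) V) [ρ.IsIrreducible],
        FSInd.indicator k (FSInd.J k n) ((FSInd.pair n).Induced ρ) = 0 ∨
          FSInd.indicator k (FSInd.J k n) ((FSInd.pair n).Induced ρ) = 1) ∧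
    -- permutations `x`, `y` in the same orbit have `F_y = F_x` and the same indicators
    (∀ (x y : FSInd.S n), y ∈ (FSInd.pair n).orbit x →
      ∃ h : (FSInd.pair n).stab y = (FSInd.pair n).stab x,
        ∀ (V : Type*) [AddCommGroup V] [Module k V]
          (ρ : Representation k ((FSInd.pair n).stab x) V) [ρ.IsIrreducible],
          FSInd.indicator k (FSInd.J k n) ((FSInd.pair n).Induced ρ) =
            FSInd.indicator k (FSInd.J k n) ((FSInd.pair n).Induced
              (x := y) (ρ.comp (MulEquiv.subgroupCongr h).toMonoidHom))) := by
  have := Fintype.ofFinite (FSInd.C n)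
  refine ⟨?_, ?_, ?_⟩
  · intro hn W _ _ _ _ _
    obtain ⟨x, hx⟩ := FSInd.Bismash.exists_isConcentrated (k := k) (M := FSInd.pair n) W
    exact hx.indicator_eq_zero_or_one
      ((FSInd.odd_orbit_or_odd_stab hn x).imp_right Or.inl)
  · intro x t ht hx h V _ _ ρ _
    refine (FSInd.MatchedPair.Induced.isConcentrated ρ).indicator_eq_zero_or_one ?_
    rcases h with h | h | h
    · exact Or.inl (FSInd.odd_orbit_of_stab_eq ht hx h)
    · exact Or.inr (Or.inr h)
    · exact (FSInd.odd_orbit_or_odd_stab (Or.inr h) x).imp_right Or.inl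
  · intro x y hy
    refine ⟨(FSInd.pair n).stab_eq_of_mem_orbit hy, fun V _ _ ρ _ => ?_⟩
    refine FSInd.MatchedPair.Induced.indicator_eq_of_mem_orbit ρ _ hy fun b c hbc => ?_
    exact congrArg ρ (Subtype.ext hbc)
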